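/- Let $C=\{x+ey : x,y\in\mathbb R\}$, $e^2=1$, be the algebra of para-complex numbers, and for a smooth $C$-valued function of para-complex coordinates $z^a=x^a+ey^a$ put $\partial_a=\frac{\partial}{\partial z^a}=\frac12\left(\frac{\partial}{\partial x^a}+e\frac{\partial}{\partial y^a}\right)$. A map is para-holomorphic if it is smooth and its real differential commutes with the para-complex structures (multiplication by $e$ on $C^m$); a para-complex manifold of dimension $m=\dim_C$ is a manifold with an atlas of charts into $C^m$ whose transition functions are para-holomorphic; a para-complex Lie group is a group that is a para-complex manifold and whose multiplication and inversion are para-holomorphic. Sums over repeated indices are understood. Let $G$ be a para-complex Lie group with $\dim_C G=m$. Let $u=(u^a)$ be para-holomorphic coordinates around the identity $1\in G$, and let $w=\phi(z,v)$ be the multiplication in these coordinates. Put $$A^a_{bc}=\frac{\partial^2\phi^a}{\partial z^b\,\partial v^c}\Big|_{z=v=u(1)},\qquad C^a_{bc}=A^a_{bc}-A^a_{cb},\qquad C_{ab}=C^c_{ad}C^d_{bc}.$$ In any para-holomorphic coordinates $(z^a)$ on an open subset of $G$ let $\lambda^a=\lambda^a_b\,dz^b$ be the right-invariant forms, $\lambda^a_b(z)=\frac{\partial}{\partial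 z'^b}\,u^a(z'z^{-1})\big|_{z'=z}$, let $(\widetilde\lambda^a_b)$ be the inverse matrix of $(\lambda^a_b)$, and let $$g_{ab}(z)=C_{pq}\,\lambda^p_a(z)\,\lambda^q_b(z)$$ be the Cartan–Killing metric. For a torsion-free connection with coefficients $L^c_{ab}$, let $R^d_{c,ab}=\partial_aL^d_{cb}-\partial_bL^d_{ca}+L^f_{cb}L^d_{fa}-L^f_{ca}L^d_{fb}$ be the components of its curvature $R(X,Y)Z=[D_X,D_Y]Z-D_{[X,Y]}Z$, that is, $R(\partial_a,\partial_b)\partial_c=R^d_{c,ab}\,\partial_d$, and let $\mathrm{Ric}(X,Y)=\mathrm{Tr}\{Z\mapsto R(Z,X)Y\}$ be its Ricci tensor, that is, $R_{ac}=R^b_{c,ba}$. Suppose that $G$ is semi-simple, i.e. that its Cartan–Killing form is non-degenerate: $\det(C_{ab})$ is invertible in $C$. Then the para-holomorphic scalar curvature of $G$ is constant: in all para-holomorphic coordinates and at every point, $$g^{ab}R_{ab}=-\tfrac14\,\dim_C G ,$$ where $R_{ab}$ is the Ricci tensor of the Levi-Civita connection of $g$, $\Gamma^c_{ab}=\frac12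 g^{cd}\left(\partial_ag_{bd}+\partial_bg_{ad}-\partial_dg_{ab}\right)$. The same holds for the Ricci tensor of the canonical torsion-free connection $\Gamma^a_{bc}=\widetilde\lambda^a_d\left(\partial_c\lambda^d_b+\frac12C^d_{pq}\lambda^p_b\lambda^q_c\right)$. -/

import Mathlib

open scoped Manifold ContDiff

noncomputable section

/-- The algebra of para-complex numbers `x + e y` with `x y : ℝ` and `e ^ 2 = 1`. -/
abbrev ParaComplex : Type := QuadraticAlgebra ℝ 1 0

namespace ParaComplex

/-- The para-complex unit `e = (0, 1)`. -/
def e : ParaComplex := ⟨0, 1⟩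

theorem e_mul_e : e * e = 1 := by
  apply QuadraticAlgebra.ext <;>
    simp [e, QuadraticAlgebra.re_one, QuadraticAlgebra.im_one]

/-- The real-linear isomorphism `x + e y ↦ (x, y)`. -/
def toProd : ParaComplex →ₗ[ℝ] ℝ × ℝ where
  toFun z := (z.re, z.im)
  map_add' _ _ := by simp
  map_smul' _ _ := by simp

theorem toProd_injective : Function.Injective toProd := by
  intro z w h
  have h' : (z.re, z.im) = (w.re, w.im) := h
  rw [Prod.mk.injEq] at h'
  exact QuadraticAlgebra.ext h'.1 h'.2

/-- The norm of `ℝ × ℝ`; it only serves to give `ParaComplex` its topology and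
its smooth structure as a two-dimensional real vector space. -/
instance instNormedAddCommGroup : NormedAddCommGroup ParaComplex :=
  NormedAddCommGroup.induced ParaComplex (ℝ × ℝ) toProd toProd_injective

instance instNormedSpace : NormedSpace ℝ ParaComplex :=
  NormedSpace.induced ℝ ParaComplex (ℝ × ℝ) toProd

end ParaComplex

/-- The space `C ^ m`, where `C` is the algebra of para-complex numbers.  It is a real normed
space, and its para-complex structure is multiplication by `e`. -/
abbrev ParaSpace (m : ℕ) : Type := Fin m → ParaComplex

/-- `f` is para-holomorphic on the open set `s` of `C ^ m`: it is smooth there and its real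
differential commutes with the para-complex structures. -/
def ParaHolomorphicOn {m : ℕ} (f : ParaSpace m → ParaSpace m) (s : Set (ParaSpace m)) : Prop :=
  ContDiffOn ℝ ∞ f s ∧
    ∀ x ∈ s, ∀ v : ParaSpace m, fderiv ℝ f x (ParaComplex.e • v) = ParaComplex.e • fderiv ℝ f x v

/-- The pregroupoid of para-holomorphic maps between open subsets of `C ^ m`.  The condition
`IsOpen s` is automatic wherever the pregroupoid is used. -/
def paraHolomorphicPregroupoid (m : ℕ) : Pregroupoid (ParaSpace m) where
  property f s := IsOpen s → ParaHolomorphicOn f s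
  comp := by
    intro f g u v hf hg hu hv huv _
    obtain ⟨hf1, hf2⟩ := hf hu
    obtain ⟨hg1, hg2⟩ := hg hv
    refine ⟨(hg1.comp (hf1.mono Set.inter_subset_left) fun y hy => hy.2), ?_⟩
    rintro x ⟨hxu, hxv⟩ w
    have hfx : DifferentiableAt ℝ f x :=
      (hf1.contDiffAt (hu.mem_nhds hxu)).differentiableAt (by simp)
    have hgx : DifferentiableAt ℝ g (f x) :=
      (hg1.contDiffAt (hv.mem_nhds hxv)).differentiableAt (by simp)
    rw [fderiv_comp x hgx hfx]
    simp only [ContinuousLinearMap.comp_apply]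
    rw [hf2 x hxu, hg2 (f x) hxv]
  id_mem := by
    intro _
    exact ⟨contDiffOn_id, fun x _ v => by simp⟩
  locality := by
    intro f u hu h _
    refine ⟨fun x hx => ?_, fun x hx => ?_⟩
    · obtain ⟨v, hv, hxv, hP⟩ := h x hx
      exact (((hP (hu.inter hv)).1).contDiffAt
        ((hu.inter hv).mem_nhds ⟨hx, hxv⟩)).contDiffWithinAt
    · obtain ⟨v, hv, hxv, hP⟩ := h x hx
      exact (hP (hu.inter hv)).2 x ⟨hx, hxv⟩
  congr := by
    intro f g u hu hfg hf _
    obtain ⟨hf1, hf2⟩ := hf hu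
    refine ⟨hf1.congr hfg, fun x hx v => ?_⟩
    have hEq : g =ᶠ[nhds x] f := Filter.eventuallyEq_of_mem (hu.mem_nhds hx) hfg
    rw [hEq.fderiv_eq]
    exact hf2 x hx v

/-- The groupoid of para-holomorphic diffeomorphisms between open subsets of `C ^ m`. -/
def paraHolomorphicGroupoid (m : ℕ) : StructureGroupoid (ParaSpace m) :=
  (paraHolomorphicPregroupoid m).groupoid

/-- A para-complex manifold of para-complex dimension `m`: a space with an atlas of charts into
`C ^ m` whose transition functions are para-holomorphic. -/
abbrev ParaComplexManifold (m : ℕ) (M : Type*) [TopologicalSpace M]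
    [ChartedSpace (ParaSpace m) M] : Prop :=
  HasGroupoid M (paraHolomorphicGroupoid m)

/-- A para-holomorphic coordinate system on a para-complex manifold: a chart that is compatible
with the para-holomorphic atlas. -/
def IsParaHolomorphicChart {m : ℕ} {M : Type*} [TopologicalSpace M]
    [ChartedSpace (ParaSpace m) M] (ψ : OpenPartialHomeomorph M (ParaSpace m)) : Prop :=
  ψ ∈ (paraHolomorphicGroupoid m).maximalAtlas M

/-- A map between manifolds modelled on real vector spaces with a `C`-module structure is
para-holomorphic if it is smooth and its differential intertwines the almost para-complex
structures, which in the tangent coordinates are multiplication by `e`. -/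
def IsParaHolomorphic {E H M E' H' M' : Type*}
    [NormedAddCommGroup E] [NormedSpace ℝ E] [SMul ParaComplex E] [TopologicalSpace H]
    (I : ModelWithCorners ℝ E H) [TopologicalSpace M] [ChartedSpace H M]
    [NormedAddCommGroup E'] [NormedSpace ℝ E'] [SMul ParaComplex E'] [TopologicalSpace H']
    (I' : ModelWithCorners ℝ E' H') [TopologicalSpace M'] [ChartedSpace H' M']
    (f : M → M') : Prop :=
  ContMDiff I I' ∞ f ∧ ∀ x : M,
    let df : E →L[ℝ] E' := mfderiv I I' f x
    ∀ v : E, df (ParaComplex.e • v) = ParaComplex.e • df v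

/-- A para-complex Lie group of para-complex dimension `m`: a group that is a para-complex
manifold, with para-holomorphic multiplication and inversion. -/
class ParaComplexLieGroup (m : ℕ) (G : Type*) [Group G] [TopologicalSpace G]
    [ChartedSpace (ParaSpace m) G] : Prop extends HasGroupoid G (paraHolomorphicGroupoid m) where
  mul_paraHolomorphic :
    IsParaHolomorphic (𝓘(ℝ, ParaSpace m).prod 𝓘(ℝ, ParaSpace m)) 𝓘(ℝ, ParaSpace m)
      (fun p : G × G => p.1 * p.2)
  inv_paraHolomorphic :
    IsParaHolomorphic 𝓘(ℝ, ParaSpace m) 𝓘(ℝ, ParaSpace m) (fun z : G => z⁻¹)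

/-- The operator `∂ / ∂z^a = (1 / 2) (∂ / ∂x^a + e ∂ / ∂y^a)`, where `z^a = x^a + e y^a`. -/
def paraPartial {m : ℕ} (a : Fin m) (f : ParaSpace m → ParaComplex) (x : ParaSpace m) :
    ParaComplex :=
  (1 / 2 : ℝ) • (fderiv ℝ f x (Pi.single a 1)
    + ParaComplex.e * fderiv ℝ f x (Pi.single a ParaComplex.e))

section LocalGeometry

/-! Tensors and connections on an open set of `C ^ m`, given by their components. -/

variable {m : ℕ}

/-- The Christoffel symbols `Γ^c_{ab}` of a metric with components `g_{ab}`. -/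
def christoffel (g : ParaSpace m → Matrix (Fin m) (Fin m) ParaComplex)
    (c a b : Fin m) (x : ParaSpace m) : ParaComplex :=
  (1 / 2 : ℝ) • ∑ d, (g x)⁻¹ c d *
    (paraPartial a (fun y => g y b d) x + paraPartial b (fun y => g y a d) x
      - paraPartial d (fun y => g y a b) x)

/-- The `∂_d` component of `R(∂_a, ∂_b) ∂_c`, where `R(X, Y) Z = [D_X, D_Y] Z - D_{[X, Y]} Z` is
the curvature of the torsion-free connection `D` with coefficients `L^c_{ab}` (`L c a b`). -/
def curvature (L : Fin m → Fin m → Fin m → ParaSpace m → ParaComplex)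
    (d c a b : Fin m) (x : ParaSpace m) : ParaComplex :=
  paraPartial a (L d c b) x - paraPartial b (L d c a) x
    + ∑ f, (L f c b x * L d f a x - L f c a x * L d f b x)

/-- The Ricci tensor `Ric(X, Y) = Tr (Z ↦ R(Z, X) Y)`; here `X = ∂_a` and `Y = ∂_c`. -/
def ricci (L : Fin m → Fin m → Fin m → ParaSpace m → ParaComplex)
    (a c : Fin m) (x : ParaSpace m) : ParaComplex :=
  ∑ b, curvature L b c b a x

/-- The scalar curvature `g^{ab} R_{ab}`. -/
def scalarCurvature (g : ParaSpace m → Matrix (Fin m) (Fin m) ParaComplex)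
    (L : Fin m → Fin m → Fin m → ParaSpace m → ParaComplex) (x : ParaSpace m) : ParaComplex :=
  ∑ a, ∑ b, (g x)⁻¹ a b * ricci L a b x

end LocalGeometry

namespace ParaComplexLieGroup

variable {m : ℕ} {G : Type*} [Group G] [TopologicalSpace G]

/-! Below, `u` is a para-holomorphic coordinate system around the identity, which fixes a basis of
the para-holomorphic tangent space at the identity, and `ψ` is any para-holomorphic coordinate
system of the group. -/

/-- The coefficients `A^a_{bc} = ∂² φ^a / ∂z^b ∂v^c` at the identity, where
`φ(z, v)` is the group multiplication in the coordinates `u`. -/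
def mulCoeff (u : OpenPartialHomeomorph G (ParaSpace m)) (a b c : Fin m) : ParaComplex :=
  paraPartial c
    (fun v => paraPartial b (fun z => u (u.symm z * u.symm v) a) (u 1)) (u 1)

/-- The structure constants `C^a_{bc} = A^a_{bc} - A^a_{cb}`. -/
def structureConst (u : OpenPartialHomeomorph G (ParaSpace m)) (a b c : Fin m) : ParaComplex :=
  mulCoeff u a b c - mulCoeff u a c b

/-- The Cartan-Killing elements `C_{ab} = C^c_{ad} C^d_{bc}`. -/
def cartanKilling (u : OpenPartialHomeomorph G (ParaSpace m)) :
    Matrix (Fin m) (Fin m) ParaComplex :=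
  fun a b => ∑ c, ∑ d, structureConst u c a d * structureConst u d b c

/-- The group is semi-simple: its Cartan-Killing form is non-degenerate.  Since para-complex
numbers have zero divisors, this means that the determinant is invertible.  The condition does not
depend on the coordinates `u` around the identity. -/
def IsSemisimple (u : OpenPartialHomeomorph G (ParaSpace m)) : Prop :=
  IsUnit (cartanKilling u).det

/-- The components `λ^a_b(z)` of the right-invariant `1`-forms `λ^a = λ^a_b dz^b` in the
coordinates `ψ`: the derivative of the `a`-th coordinate of `z' z⁻¹` in `z'^b`, at `z' = z`. -/
def rightForm (u ψ : OpenPartialHomeomorph G (ParaSpace m)) (x : ParaSpace m) :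
    Matrix (Fin m) (Fin m) ParaComplex :=
  fun a b => paraPartial b (fun x' => u (ψ.symm x' * (ψ.symm x)⁻¹) a) x

/-- The components `g_{ab} = C_{pq} λ^p_a λ^q_b` of the Cartan-Killing metric. -/
def killingMetric (u ψ : OpenPartialHomeomorph G (ParaSpace m)) (x : ParaSpace m) :
    Matrix (Fin m) (Fin m) ParaComplex :=
  fun a b => ∑ p, ∑ q, cartanKilling u p q * rightForm u ψ x p a * rightForm u ψ x q b

/-- The coefficients of the canonical torsion-free connection of the group,
`Γ^a_{bc} = λ̃^a_d (∂_c λ^d_b + (1 / 2) C^d_{pq} λ^p_b λ^q_c)`, where `λ̃` is the inverse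
matrix of `λ`. -/
def canonicalConnection (u ψ : OpenPartialHomeomorph G (ParaSpace m))
    (a b c : Fin m) (x : ParaSpace m) : ParaComplex :=
  ∑ d, (rightForm u ψ x)⁻¹ a d *
    (paraPartial c (fun y => rightForm u ψ y d b) x
      + (1 / 2 : ℝ) • ∑ p, ∑ q,
          structureConst u d p q * rightForm u ψ x p b * rightForm u ψ x q c)

end ParaComplexLieGroup

end

/-! The operators `∂/∂z^a` commute, obey the Leibniz rule and satisfy the chain rule along
para-holomorphic inner maps, so the classical tensor computation for a bi-invariant metric carries
over. The coefficients have zero divisors, but only the determinants of `λ` and of the Killing form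
and the real number 2 are ever inverted.

Write `λ_b` for the `b`-th column of `λ` and `N_b` for the matrix of `w ↦ [w, λ_b]`. Commuting
second derivatives of right translations give the Maurer-Cartan equation `∂_c λ_b - ∂_b λ_c = -N_c
λ_b` (`maurerCartan_rightForm`). Differentiating it once more gives the Jacobi identity
(`jacobi_cyclic`), so associativity is never expanded to third order.

The canonical connection satisfies `λ Γ_c = ∂_c λ + (1/2) N_c λ`. Its curvature is a quarter of a
commutator of the `N`'s (`curvature_connectionMatrix`), whose trace is `-(1/4) tr (N_a N_c)`
(`ricci_eq`). Since the metric is `g_ab = tr (N_a N_b)`, the Ricci tensor is `-(1/4) g` and its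
contraction is `-m/4`. The connection is symmetric and preserves `g`, so it is the Levi-Civita
connection (`christoffel_eq`) and both claims are one computation. -/

noncomputable section

open ParaComplex

/-! ### Differentiating products of para-complex functions. -/

namespace ParaComplex

/-- Multiplication of para-complex numbers as a continuous bilinear map. -/
def mulL : ParaComplex →L[ℝ] ParaComplex →L[ℝ] ParaComplex :=
  (LinearMap.mul ℝ ParaComplex).toContinuousBilinearMap

@[simp] theorem mulL_apply (a b : ParaComplex) : mulL a b = a * b := rfl

theorem eq_re_add_im_mul_e (w : ParaComplex) : w = w.re • (1 : ParaComplex) + w.im • e := by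
  apply QuadraticAlgebra.ext <;>
    simp [e, QuadraticAlgebra.re_one, QuadraticAlgebra.im_one]

section

variable {E : Type*} [NormedAddCommGroup E] [NormedSpace ℝ E] {f g : E → ParaComplex} {x : E}

theorem contDiffAt_mul {n : ℕ∞ω} (hf : ContDiffAt ℝ n f x) (hg : ContDiffAt ℝ n g x) :
    ContDiffAt ℝ n (fun y => f y * g y) x :=
  ((mulL.contDiff.contDiffAt.comp x hf).clm_apply hg :)

theorem hasFDerivAt_mul {f' g' : E →L[ℝ] ParaComplex} (hf : HasFDerivAt f f' x)
    (hg : HasFDerivAt g g' x) :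
    HasFDerivAt (fun y => f y * g y) (mulL (f x) ∘L g' + (mulL.flip (g x)) ∘L f') x := by
  have := mulL.hasFDerivAt_of_bilinear hf hg
  refine this.congr_fderiv ?_
  ext v <;> simp

end

end ParaComplex

/-! ### Calculus of the operators `∂/∂z^a`. -/

section Calculus

variable {m : ℕ} {f g : ParaSpace m → ParaComplex} {x : ParaSpace m}

theorem paraPartial_congr {a : Fin m} (h : f =ᶠ[nhds x] g) :
    paraPartial a f x = paraPartial a g x := by
  simp only [paraPartial, h.fderiv_eq]

theorem paraPartial_const (a : Fin m) (c : ParaComplex) (x : ParaSpace m) :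
    paraPartial a (fun _ => c) x = 0 := by
  simp [paraPartial]

theorem paraPartial_add (a : Fin m) (hf : DifferentiableAt ℝ f x) (hg : DifferentiableAt ℝ g x) :
    paraPartial a (fun y => f y + g y) x = paraPartial a f x + paraPartial a g x := by
  simp only [paraPartial, fderiv_fun_add hf hg, add_apply, mul_add, ← smul_add]
  congr 1; abel

theorem paraPartial_sub (a : Fin m) (hf : DifferentiableAt ℝ f x) (hg : DifferentiableAt ℝ g x) :
    paraPartial a (fun y => f y - g y) x = paraPartial a f x - paraPartial a g x := by
  simp only [paraPartial, fderiv_fun_sub hf hg, sub_apply, mul_sub, ← smul_sub]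
  congr 1; abel

theorem paraPartial_sum {ι : Type*} (s : Finset ι) (a : Fin m)
    {f : ι → ParaSpace m → ParaComplex} (hf : ∀ i, DifferentiableAt ℝ (f i) x) :
    paraPartial a (fun y => ∑ i ∈ s, f i y) x = ∑ i ∈ s, paraPartial a (f i) x := by
  simp only [paraPartial, fderiv_fun_sum fun i _ => hf i, sum_apply,
    Finset.mul_sum, ← Finset.sum_add_distrib, Finset.smul_sum]

theorem paraPartial_mul (a : Fin m) (hf : DifferentiableAt ℝ f x) (hg : DifferentiableAt ℝ g x) :
    paraPartial a (fun y => f y * g y) x = paraPartial a f x * g x + f x * paraPartial a g x := by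
  simp only [paraPartial, (hasFDerivAt_mul hf.hasFDerivAt hg.hasFDerivAt).fderiv,
    add_apply, ContinuousLinearMap.comp_apply, mulL_apply,
    ContinuousLinearMap.flip_apply, smul_mul_assoc, mul_smul_comm, ← smul_add]
  congr 1; ring

theorem paraPartial_const_mul (a : Fin m) (c : ParaComplex) (hf : DifferentiableAt ℝ f x) :
    paraPartial a (fun y => c * f y) x = c * paraPartial a f x := by
  rw [paraPartial_mul a (differentiableAt_const c) hf, paraPartial_const]; ring

theorem paraPartial_const_smul (a : Fin m) (r : ℝ) (hf : DifferentiableAt ℝ f x) :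
    paraPartial a (fun y => r • f y) x = r • paraPartial a f x := by
  simp only [paraPartial, fderiv_fun_const_smul hf, smul_apply,
    mul_smul_comm, smul_add, smul_comm r]

theorem paraPartial_coord (a b : Fin m) (x : ParaSpace m) :
    paraPartial b (fun y => y a) x = (1 : Matrix (Fin m) (Fin m) ParaComplex) a b := by
  have h : fderiv ℝ (fun y : ParaSpace m => y a) x
      = ContinuousLinearMap.proj (R := ℝ) (φ := fun _ : Fin m => ParaComplex) a :=
    (ContinuousLinearMap.proj (R := ℝ) (φ := fun _ : Fin m => ParaComplex) a).fderiv
  rw [paraPartial, h]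
  by_cases hab : a = b
  · subst hab
    simp [e_mul_e, ← two_smul ℝ (1 : ParaComplex), smul_smul]
  · simp [Matrix.one_apply_ne hab, Pi.single_eq_of_ne hab]

section Parametric

variable {E : Type*} [NormedAddCommGroup E] [NormedSpace ℝ E]

/-- Partial derivatives in the first variable of a smooth function depend smoothly on
parameters. -/
theorem contDiffAt_paraPartial_param (a : Fin m) {h : E → ParaSpace m → ParaComplex}
    {k : E → ParaSpace m} {y : E}
    (hh : ContDiffAt ℝ ∞ (fun p : E × ParaSpace m => h p.1 p.2) (y, k y))
    (hk : ContDiffAt ℝ ∞ k y) :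
    ContDiffAt ℝ ∞ (fun y => paraPartial a (h y) (k y)) y := by
  have hd : ContDiffAt ℝ ∞ (fun y => fderiv ℝ (h y) (k y)) y :=
    ContDiffAt.fderiv (n := ∞) (m := ∞) hh hk (by simp)
  exact ((hd.clm_apply contDiffAt_const).add
    (contDiffAt_mul contDiffAt_const (hd.clm_apply contDiffAt_const))).const_smul _

end Parametric

theorem contDiffAt_paraPartial (a : Fin m) (hf : ContDiffAt ℝ ∞ f x) :
    ContDiffAt ℝ ∞ (fun y => paraPartial a f y) x :=
  contDiffAt_paraPartial_param a (h := fun _ : ParaSpace m => f) (k := id)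
    (ContDiffAt.comp (g := f) (f := Prod.snd) (x, x) hf contDiffAt_snd) contDiffAt_id

/-- Each operator is a constant-coefficient combination of real directional derivatives, so symmetry
of the second real differential suffices. Para-holomorphy plays no role. -/
theorem paraPartial_comm (a b : Fin m) (hf : ContDiffAt ℝ ∞ f x) :
    paraPartial a (fun y => paraPartial b f y) x = paraPartial b (fun y => paraPartial a f y) x := by
  have hd : ContDiffAt ℝ ∞ (fderiv ℝ f) x := hf.fderiv_right (by simp)
  have hd1 : DifferentiableAt ℝ (fderiv ℝ f) x := hd.differentiableAt (by simp)
  have hsymm : IsSymmSndFDerivAt ℝ f x := hf.isSymmSndFDerivAt (by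
    rw [minSmoothness_of_isRCLikeNormedField]; exact WithTop.coe_le_coe.2 le_top)
  have key : ∀ (c : Fin m) (w : ParaSpace m), fderiv ℝ (fun y => paraPartial c f y) x w
      = (1 / 2 : ℝ) • (fderiv ℝ (fderiv ℝ f) x w (Pi.single c 1)
        + e * fderiv ℝ (fderiv ℝ f) x w (Pi.single c e)) := by
    intro c w
    have h1 : ∀ v : ParaSpace m, HasFDerivAt (fun y => fderiv ℝ f y v)
        ((fderiv ℝ (fderiv ℝ f) x).flip v) x := fun v => by
      have := hd1.hasFDerivAt.clm_apply (hasFDerivAt_const v x)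
      refine this.congr_fderiv ?_
      ext <;> simp
    have h2 := (((h1 (Pi.single c 1)).add
      (hasFDerivAt_mul (hasFDerivAt_const e x) (h1 (Pi.single c e)))).const_smul (1 / 2 : ℝ))
    have h3 : HasFDerivAt (fun y => paraPartial c f y) _ x := h2
    rw [h3.fderiv]
    simp
  have s := fun v w => hsymm.eq v w
  rw [paraPartial, paraPartial]
  simp only [key]
  rw [s (Pi.single b 1) (Pi.single a 1), s (Pi.single b 1) (Pi.single a e),
    s (Pi.single b e) (Pi.single a 1), s (Pi.single b e) (Pi.single a e)]
  simp only [mul_add, mul_smul_comm, ← smul_add]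
  congr 2
  abel

/-- A map is para-holomorphic at a point, to first order: it is differentiable there and its
differential commutes with multiplication by `e`. -/
def ParaDifferentiableAt {V W : Type*} [NormedAddCommGroup V] [NormedSpace ℝ V]
    [SMul ParaComplex V] [NormedAddCommGroup W] [NormedSpace ℝ W] [SMul ParaComplex W]
    (f : V → W) (x : V) : Prop :=
  DifferentiableAt ℝ f x ∧ ∀ v, fderiv ℝ f x (e • v) = e • fderiv ℝ f x v

/-- Para-linearity turns the second term of `∂/∂z^b` into `e * e = 1` times the first, and the
factor 1/2 averages two equal terms. -/
theorem ParaDifferentiableAt.fderiv_single {F : ParaSpace m → ParaSpace m}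
    (hF : ParaDifferentiableAt F x) (b : Fin m) (p : Fin m) :
    fderiv ℝ F x (Pi.single b 1) p = paraPartial b (fun y => F y p) x := by
  have h : fderiv ℝ (fun y => F y p) x
      = (ContinuousLinearMap.proj (R := ℝ) (φ := fun _ : Fin m => ParaComplex) p).comp
        (fderiv ℝ F x) := by
    exact ((ContinuousLinearMap.proj (R := ℝ)
      (φ := fun _ : Fin m => ParaComplex) p).hasFDerivAt.comp x hF.1.hasFDerivAt).fderiv
  have hs : (Pi.single b e : ParaSpace m) = e • Pi.single b 1 := by
    rw [← Pi.single_smul]; simp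
  rw [paraPartial, h, hs]
  simp only [ContinuousLinearMap.comp_apply, hF.2, ContinuousLinearMap.proj_apply, Pi.smul_apply,
    smul_eq_mul]
  rw [← mul_assoc, e_mul_e, one_mul, ← two_smul ℝ, smul_smul]
  norm_num

/-- The chain rule: only the inner map has to be para-holomorphic. -/
theorem paraPartial_comp {F : ParaSpace m → ParaSpace m} (hF : ParaDifferentiableAt F x)
    (hg : DifferentiableAt ℝ g (F x)) (b : Fin m) :
    paraPartial b (fun y => g (F y)) x
      = ∑ p, paraPartial p g (F x) * paraPartial b (fun y => F y p) x := by
  have h : fderiv ℝ (fun y => g (F y)) x = (fderiv ℝ g (F x)).comp (fderiv ℝ F x) :=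
    fderiv_comp x hg hF.1
  have hs : (Pi.single b e : ParaSpace m) = e • Pi.single b 1 := by
    rw [← Pi.single_smul]; simp
  rw [paraPartial, h, hs]
  simp only [ContinuousLinearMap.comp_apply, hF.2, ← hF.fderiv_single]
  set D := fderiv ℝ g (F x)
  set w := fderiv ℝ F x (Pi.single b 1)
  -- The differential of `g` is only real-linear, so `w` is expanded in a real basis. Multiplication
  -- by `e` swaps the real and imaginary coordinates, and the terms for `w` and `e • w` regroup into
  -- `∂_p g` times `w p`.
  have hw : w = ∑ p, ((w p).re • (Pi.single p 1 : ParaSpace m)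
      + (w p).im • (Pi.single p e : ParaSpace m)) := by
    funext q
    rw [Finset.sum_apply, Finset.sum_eq_single q]
    · simpa using eq_re_add_im_mul_e (w q)
    · intro p _ hp
      simp [Pi.single_eq_of_ne hp.symm]
    · simp
  have hew : e • w = ∑ p, ((w p).re • (Pi.single p e : ParaSpace m)
      + (w p).im • (Pi.single p 1 : ParaSpace m)) := by
    conv_lhs => rw [hw]
    rw [Finset.smul_sum]
    refine Finset.sum_congr rfl fun p _ => ?_
    have he : ∀ c, e • (Pi.single p c : ParaSpace m) = Pi.single p (e * c) := fun c => by
      rw [← Pi.single_smul, smul_eq_mul]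
    rw [smul_add, smul_comm e, smul_comm e, he, he, e_mul_e, mul_one]
  have h1 : D w = ∑ p, ((w p).re • D (Pi.single p 1) + (w p).im • D (Pi.single p e)) := by
    conv_lhs => rw [hw]
    simp
  have h2 : D (e • w) = ∑ p, ((w p).re • D (Pi.single p e) + (w p).im • D (Pi.single p 1)) := by
    rw [hew]; simp
  rw [h1, h2, Finset.mul_sum, ← Finset.sum_add_distrib, Finset.smul_sum]
  refine Finset.sum_congr rfl fun p _ => ?_
  have hp : paraPartial p g (F x) = (1 / 2 : ℝ) • (D (Pi.single p 1) + e * D (Pi.single p e)) := rfl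
  have this : e * D (Pi.single p e) * e = D (Pi.single p e) := by
    rw [mul_comm, ← mul_assoc, e_mul_e, one_mul]
  rw [hp]
  conv_rhs => rw [eq_re_add_im_mul_e (w p)]
  simp only [smul_mul_assoc, mul_add, add_mul, mul_smul_comm, mul_one, this,
    mul_comm (D (Pi.single p 1)) e]
  module

end Calculus

/-! ### Entrywise differentiation of matrix-valued functions. -/

section MatrixCalculus

variable {m n k : ℕ} {x : ParaSpace m}

/-- Smoothness at a point of a matrix-valued function. -/
def MatrixSmoothAt (A : ParaSpace m → Matrix (Fin n) (Fin k) ParaComplex) (x : ParaSpace m) :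
    Prop :=
  ∀ i j, ContDiffAt ℝ ∞ (fun y => A y i j) x

/-- The operator `∂ / ∂z^a` applied to the entries of a matrix-valued function. -/
def matrixPartial (a : Fin m) (A : ParaSpace m → Matrix (Fin n) (Fin k) ParaComplex)
    (x : ParaSpace m) : Matrix (Fin n) (Fin k) ParaComplex :=
  Matrix.of fun i j => paraPartial a (fun y => A y i j) x

theorem MatrixSmoothAt.differentiableAt {A : ParaSpace m → Matrix (Fin n) (Fin k) ParaComplex}
    (hA : MatrixSmoothAt A x) (i : Fin n) (j : Fin k) :
    DifferentiableAt ℝ (fun y => A y i j) x :=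
  (hA i j).differentiableAt (by simp)

theorem MatrixSmoothAt.matrixPartial {A : ParaSpace m → Matrix (Fin n) (Fin k) ParaComplex}
    (hA : MatrixSmoothAt A x) (a : Fin m) : MatrixSmoothAt (matrixPartial a A) x :=
  fun i j => contDiffAt_paraPartial a (hA i j)

theorem MatrixSmoothAt.add {A B : ParaSpace m → Matrix (Fin n) (Fin k) ParaComplex}
    (hA : MatrixSmoothAt A x) (hB : MatrixSmoothAt B x) :
    MatrixSmoothAt (fun y => A y + B y) x :=
  fun i j => (hA i j).add (hB i j)

theorem MatrixSmoothAt.const_smul {A : ParaSpace m → Matrix (Fin n) (Fin k) ParaComplex}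
    (r : ℝ) (hA : MatrixSmoothAt A x) : MatrixSmoothAt (fun y => r • A y) x :=
  fun i j => (hA i j).const_smul r

theorem MatrixSmoothAt.mul {l : ℕ} {A : ParaSpace m → Matrix (Fin n) (Fin k) ParaComplex}
    {B : ParaSpace m → Matrix (Fin k) (Fin l) ParaComplex}
    (hA : MatrixSmoothAt A x) (hB : MatrixSmoothAt B x) :
    MatrixSmoothAt (fun y => A y * B y) x := fun i j => by
  simp only [Matrix.mul_apply]
  exact ContDiffAt.sum fun p _ => contDiffAt_mul (hA i p) (hB p j)

theorem matrixPartial_congr {A B : ParaSpace m → Matrix (Fin n) (Fin k) ParaComplex}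
    (h : A =ᶠ[nhds x] B) (a : Fin m) : matrixPartial a A x = matrixPartial a B x := by
  ext1 i j
  exact paraPartial_congr (h.fun_comp fun M => M i j)

theorem matrixPartial_add {A B : ParaSpace m → Matrix (Fin n) (Fin k) ParaComplex}
    (hA : MatrixSmoothAt A x) (hB : MatrixSmoothAt B x) (a : Fin m) :
    matrixPartial a (fun y => A y + B y) x = matrixPartial a A x + matrixPartial a B x := by
  ext1 i j
  exact paraPartial_add a (hA.differentiableAt i j) (hB.differentiableAt i j)

theorem matrixPartial_const_smul {A : ParaSpace m → Matrix (Fin n) (Fin k) ParaComplex}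
    (r : ℝ) (hA : MatrixSmoothAt A x) (a : Fin m) :
    matrixPartial a (fun y => r • A y) x = r • matrixPartial a A x := by
  ext1 i j
  exact paraPartial_const_smul a r (hA.differentiableAt i j)

theorem matrixPartial_mul {l : ℕ} {A : ParaSpace m → Matrix (Fin n) (Fin k) ParaComplex}
    {B : ParaSpace m → Matrix (Fin k) (Fin l) ParaComplex}
    (hA : MatrixSmoothAt A x) (hB : MatrixSmoothAt B x) (a : Fin m) :
    matrixPartial a (fun y => A y * B y) x
      = matrixPartial a A x * B x + A x * matrixPartial a B x := by
  ext1 i j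
  simp only [matrixPartial, Matrix.of_apply, Matrix.mul_apply, Matrix.add_apply]
  rw [paraPartial_sum _ _ fun p =>
    (contDiffAt_mul (hA i p) (hB p j)).differentiableAt (by simp), ← Finset.sum_add_distrib]
  exact Finset.sum_congr rfl fun p _ =>
    paraPartial_mul a (hA.differentiableAt i p) (hB.differentiableAt p j)

theorem matrixPartial_comm {A : ParaSpace m → Matrix (Fin n) (Fin k) ParaComplex}
    (hA : MatrixSmoothAt A x) (a b : Fin m) :
    matrixPartial a (matrixPartial b A) x = matrixPartial b (matrixPartial a A) x := by
  ext1 i j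
  exact paraPartial_comm a b (hA i j)

theorem paraPartial_trace {A : ParaSpace m → Matrix (Fin n) (Fin n) ParaComplex}
    (hA : MatrixSmoothAt A x) (a : Fin m) :
    paraPartial a (fun y => (A y).trace) x = (matrixPartial a A x).trace := by
  simp only [Matrix.trace, Matrix.diag_apply]
  exact paraPartial_sum _ _ fun i => hA.differentiableAt i i

end MatrixCalculus

/-! ### The bracket defined by structure constants, in matrix form. -/

section StructureMatrix

open Matrix

variable {m : ℕ} (C : Fin m → Fin m → Fin m → ParaComplex)

/-- For structure constants `C^d_{pq}`, the matrix of the endomorphism `w ↦ [w, v]`. -/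
def structureMatrix : (Fin m → ParaComplex) →ₗ[ParaComplex] Matrix (Fin m) (Fin m) ParaComplex where
  toFun v := Matrix.of fun d p => ∑ q, C d p q * v q
  map_add' v w := by
    ext1 d p
    simp [mul_add, Finset.sum_add_distrib]
  map_smul' r v := by
    ext1 d p
    simp only [Matrix.of_apply, Pi.smul_apply, Matrix.smul_apply, smul_eq_mul, RingHom.id_apply,
      Finset.mul_sum]
    exact Finset.sum_congr rfl fun q _ => by ring

theorem structureMatrix_apply (v : Fin m → ParaComplex) (d p : Fin m) :
    structureMatrix C v d p = ∑ q, C d p q * v q := rfl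

variable {C}

theorem structureMatrix_mulVec_antisymm (hC : ∀ a b c, C a b c = -C a c b)
    (v w : Fin m → ParaComplex) :
    structureMatrix C v *ᵥ w = -(structureMatrix C w *ᵥ v) := by
  funext d
  simp only [Matrix.mulVec, dotProduct, structureMatrix_apply, Pi.neg_apply, Finset.sum_mul]
  rw [Finset.sum_comm, ← Finset.sum_neg_distrib]
  refine Finset.sum_congr rfl fun q _ => ?_
  rw [← Finset.sum_neg_distrib]
  refine Finset.sum_congr rfl fun p _ => ?_
  rw [hC d p q]; ring

end StructureMatrix

/-! ### Connection, curvature and metric of a Maurer-Cartan coframe. -/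

/-- A smooth coframe `λ` with inverse frame `μ` on an open set of `C ^ m` that satisfies the
Maurer-Cartan equation with structure constants `C^d_{pq}`. -/
structure IsMaurerCartanCoframe {m : ℕ} (C : Fin m → Fin m → Fin m → ParaComplex)
    (lam mu : ParaSpace m → Matrix (Fin m) (Fin m) ParaComplex) (U : Set (ParaSpace m)) :
    Prop where
  antisymm : ∀ a b c, C a b c = -C a c b
  isOpen : IsOpen U
  smooth : ∀ x ∈ U, MatrixSmoothAt lam x
  smooth_inv : ∀ x ∈ U, MatrixSmoothAt mu x
  inv_mul : ∀ x ∈ U, mu x * lam x = 1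
  maurerCartan : ∀ x ∈ U, ∀ d b c,
    paraPartial c (fun y => lam y d b) x - paraPartial b (fun y => lam y d c) x
      = -∑ p, ∑ q, C d p q * lam x p b * lam x q c

/-- The matrix of the bracket with the `a`-th coordinate field. -/
def frameMatrix {m : ℕ} (C : Fin m → Fin m → Fin m → ParaComplex)
    (lam : ParaSpace m → Matrix (Fin m) (Fin m) ParaComplex) (a : Fin m) (x : ParaSpace m) :
    Matrix (Fin m) (Fin m) ParaComplex :=
  structureMatrix C ((lam x).col a)

/-- The matrices `(Γ_c)^a_b = Γ^a_{bc}` of the canonical torsion-free connection of a coframe. -/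
def connectionMatrix {m : ℕ} (C : Fin m → Fin m → Fin m → ParaComplex)
    (lam mu : ParaSpace m → Matrix (Fin m) (Fin m) ParaComplex) (c : Fin m) (x : ParaSpace m) :
    Matrix (Fin m) (Fin m) ParaComplex :=
  mu x * (matrixPartial c lam x + (1 / 2 : ℝ) • (frameMatrix C lam c x * lam x))

namespace IsMaurerCartanCoframe

open Matrix

variable {m : ℕ} {C : Fin m → Fin m → Fin m → ParaComplex}
  {lam mu : ParaSpace m → Matrix (Fin m) (Fin m) ParaComplex} {U : Set (ParaSpace m)}
  (h : IsMaurerCartanCoframe C lam mu U) {x : ParaSpace m} (hx : x ∈ U)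

include h hx

theorem mul_inv : lam x * mu x = 1 := mul_eq_one_comm.1 (h.inv_mul x hx)

theorem smooth_frameMatrix (a : Fin m) : MatrixSmoothAt (frameMatrix C lam a) x := fun d p => by
  simp only [frameMatrix, structureMatrix_apply]
  exact ContDiffAt.sum fun q _ => contDiffAt_mul contDiffAt_const (h.smooth x hx q a)

theorem smooth_connectionMatrix (a : Fin m) : MatrixSmoothAt (connectionMatrix C lam mu a) x :=
  (h.smooth_inv x hx).mul (((h.smooth x hx).matrixPartial a).add
    (((h.smooth_frameMatrix hx a).mul (h.smooth x hx)).const_smul _))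

theorem matrixPartial_frameMatrix (a b : Fin m) :
    matrixPartial a (frameMatrix C lam b) x
      = structureMatrix C ((matrixPartial a lam x).col b) := by
  ext1 d p
  simp only [matrixPartial, of_apply, frameMatrix, structureMatrix_apply, col_apply]
  rw [paraPartial_sum _ _ fun q =>
    (contDiffAt_mul contDiffAt_const (h.smooth x hx q b)).differentiableAt (by simp)]
  exact Finset.sum_congr rfl fun q _ =>
    paraPartial_const_mul a _ ((h.smooth x hx).differentiableAt q b)

theorem col_matrixPartial_sub (b c : Fin m) :
    (matrixPartial c lam x).col b - (matrixPartial b lam x).col c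
      = -(frameMatrix C lam c x *ᵥ (lam x).col b) := by
  funext d
  refine (h.maurerCartan x hx d b c).trans ?_
  simp only [Pi.neg_apply, mulVec, dotProduct, frameMatrix, structureMatrix_apply, col_apply,
    Finset.sum_mul]
  congr 1
  exact Finset.sum_congr rfl fun p _ => Finset.sum_congr rfl fun q _ => by ring

omit hx in
theorem frameMatrix_mulVec_antisymm (a b : Fin m) :
    frameMatrix C lam a x *ᵥ (lam x).col b = -(frameMatrix C lam b x *ᵥ (lam x).col a) :=
  structureMatrix_mulVec_antisymm h.antisymm _ _

/-- This is `∂_a` of the Maurer-Cartan equation. The term `(∂_a N_c) λ_b` is the bracket of `λ_b`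
with `∂_a λ_c`, which antisymmetry turns into `-N_b ∂_a λ_c`. -/
theorem col_second_partial_sub (a b c : Fin m) :
    (matrixPartial a (matrixPartial c lam) x).col b - (matrixPartial a (matrixPartial b lam) x).col c
      = frameMatrix C lam b x *ᵥ (matrixPartial a lam x).col c
        - frameMatrix C lam c x *ᵥ (matrixPartial a lam x).col b := by
  have h1 := matrixPartial_mul (h.smooth_frameMatrix hx c) (h.smooth x hx) a
  rw [h.matrixPartial_frameMatrix hx] at h1
  have h2 : ∀ d, paraPartial a (fun y => (matrixPartial c lam y) d b
      - (matrixPartial b lam y) d c) x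
      = paraPartial a (fun y => (-1 : ℝ) • (frameMatrix C lam c y * lam y) d b) x := fun d => by
    refine paraPartial_congr ?_
    filter_upwards [h.isOpen.mem_nhds hx] with y hy
    have := congrFun (h.col_matrixPartial_sub hy b c) d
    rw [neg_one_smul]
    exact this
  funext d
  have h3 := h2 d
  rw [paraPartial_sub _ (((h.smooth x hx).matrixPartial c).differentiableAt d b)
    (((h.smooth x hx).matrixPartial b).differentiableAt d c), paraPartial_const_smul _ _
    (((h.smooth_frameMatrix hx c).mul (h.smooth x hx)).differentiableAt d b)] at h3
  have h4 := congrFun (congrFun h1 d) b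
  have h5 := congrFun (structureMatrix_mulVec_antisymm h.antisymm
    ((matrixPartial a lam x).col c) ((lam x).col b)) d
  refine h3.trans ?_
  refine (congrArg _ h4).trans ?_
  simp only [mulVec, dotProduct, col_apply, Matrix.mul_apply, Matrix.add_apply, Pi.neg_apply,
    Pi.sub_apply, frameMatrix] at h5 ⊢
  rw [h5]
  module

/-- The Jacobi identity, obtained by differentiating the Maurer-Cartan equation. -/
theorem jacobi_cyclic (a b c : Fin m) :
    frameMatrix C lam a x *ᵥ frameMatrix C lam b x *ᵥ (lam x).col c
      + frameMatrix C lam b x *ᵥ frameMatrix C lam c x *ᵥ (lam x).col a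
      + frameMatrix C lam c x *ᵥ frameMatrix C lam a x *ᵥ (lam x).col b = 0 := by
  -- In the cyclic sum all second derivatives cancel. The first derivatives pair into differences
  -- `∂_i λ_j - ∂_j λ_i`, which Maurer-Cartan replaces by brackets.
  have e1 := h.col_second_partial_sub hx a b c
  have e2 := h.col_second_partial_sub hx c a b
  have e3 := h.col_second_partial_sub hx b c a
  rw [matrixPartial_comm (h.smooth x hx) a c] at e1
  rw [matrixPartial_comm (h.smooth x hx) c b] at e2
  rw [matrixPartial_comm (h.smooth x hx) b a] at e3
  have f := fun i j k => congrArg (frameMatrix C lam i x *ᵥ ·) (h.col_matrixPartial_sub hx j k)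
  have f1 := f b a c
  have f2 := f c b a
  have f3 := f a c b
  simp only [mulVec_sub, mulVec_neg] at f1 f2 f3
  rw [← sub_eq_zero] at e1 e2 e3 f1 f2 f3
  linear_combination (norm := module) f1 + f2 + f3 - e1 - e2 - e3

/-- The Jacobi identity read as an identity of endomorphisms. It is tested on the columns of `λ`
only, which suffices because `λ` is invertible. -/
theorem structureMatrix_bracket (a b : Fin m) :
    structureMatrix C (frameMatrix C lam a x *ᵥ (lam x).col b)
      = frameMatrix C lam a x * frameMatrix C lam b x
        - frameMatrix C lam b x * frameMatrix C lam a x := by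
  have key : structureMatrix C (frameMatrix C lam a x *ᵥ (lam x).col b) * lam x
      = (frameMatrix C lam a x * frameMatrix C lam b x
        - frameMatrix C lam b x * frameMatrix C lam a x) * lam x := by
    have hcol : ∀ (A : Matrix (Fin m) (Fin m) ParaComplex) (d c : Fin m),
        (A * lam x) d c = (A *ᵥ (lam x).col c) d := fun _ _ _ => rfl
    ext1 d c
    rw [hcol, hcol]
    refine congrFun ?_ d
    rw [structureMatrix_mulVec_antisymm h.antisymm, sub_mulVec, ← mulVec_mulVec, ← mulVec_mulVec,
      h.frameMatrix_mulVec_antisymm a c, mulVec_neg]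
    have := h.jacobi_cyclic hx a b c
    change -(frameMatrix C lam c x *ᵥ _) = _
    linear_combination (norm := module) -this
  have := congrArg (· * mu x) key
  simpa only [mul_assoc, h.mul_inv hx, mul_one] using this

/-- Differentiating this form of the definition avoids derivatives of the inverse frame `μ`. -/
theorem mul_connectionMatrix (c : Fin m) :
    lam x * connectionMatrix C lam mu c x
      = matrixPartial c lam x + (1 / 2 : ℝ) • (frameMatrix C lam c x * lam x) := by
  rw [connectionMatrix, ← mul_assoc, h.mul_inv hx, one_mul]

/-- Absence of torsion: antisymmetrizing the half bracket yields a full bracket, which cancels the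
Maurer-Cartan term. -/
theorem connectionMatrix_symm (a b c : Fin m) :
    connectionMatrix C lam mu c x a b = connectionMatrix C lam mu b x a c := by
  have hcol : ∀ (A : Matrix (Fin m) (Fin m) ParaComplex) (b : Fin m),
      (mu x * A) a b = (mu x *ᵥ A.col b) a := fun _ _ => rfl
  rw [connectionMatrix, connectionMatrix, hcol, hcol]
  refine congrFun (congrArg _ ?_) a
  have e1 := h.col_matrixPartial_sub hx b c
  have e2 := h.frameMatrix_mulVec_antisymm (x := x) c b
  have hc : ∀ b c, (matrixPartial c lam x + (1 / 2 : ℝ) • (frameMatrix C lam c x * lam x)).col b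
      = (matrixPartial c lam x).col b
        + (1 / 2 : ℝ) • (frameMatrix C lam c x *ᵥ (lam x).col b) := fun _ _ => rfl
  rw [hc, hc]
  linear_combination (norm := module) e1 - (1 / 2 : ℝ) • e2

theorem matrixPartial_frameMatrix_sub (a b : Fin m) :
    matrixPartial a (frameMatrix C lam b) x - matrixPartial b (frameMatrix C lam a) x
      = frameMatrix C lam b x * frameMatrix C lam a x
        - frameMatrix C lam a x * frameMatrix C lam b x := by
  rw [h.matrixPartial_frameMatrix hx, h.matrixPartial_frameMatrix hx, ← map_sub,
    h.col_matrixPartial_sub hx, map_neg, h.structureMatrix_bracket hx, neg_sub]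

/-- Differentiate `λ Γ_b = ∂_b λ + (1/2) N_b λ` and antisymmetrize. Terms containing derivatives of
`λ` cancel, and what remains is `(1/2) [N_b, N_a]` from the derivatives of `N` plus `(1/4) [N_a,
N_b]` from the product. -/
theorem curvature_connectionMatrix (a b : Fin m) :
    lam x * (matrixPartial a (connectionMatrix C lam mu b) x
        - matrixPartial b (connectionMatrix C lam mu a) x
        + (connectionMatrix C lam mu a x * connectionMatrix C lam mu b x
        - connectionMatrix C lam mu b x * connectionMatrix C lam mu a x))
      = (1 / 4 : ℝ) • ((frameMatrix C lam b x * frameMatrix C lam a x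
        - frameMatrix C lam a x * frameMatrix C lam b x) * lam x) := by
  have hs := h.smooth x hx
  have key : ∀ a b, lam x * matrixPartial a (connectionMatrix C lam mu b) x
      + lam x * (connectionMatrix C lam mu a x * connectionMatrix C lam mu b x)
      = matrixPartial a (matrixPartial b lam) x
        + (1 / 2 : ℝ) • (matrixPartial a (frameMatrix C lam b) x * lam x)
        + (1 / 2 : ℝ) • (frameMatrix C lam b x * matrixPartial a lam x)
        + (1 / 2 : ℝ) • (frameMatrix C lam a x * matrixPartial b lam x)
        + (1 / 4 : ℝ) • (frameMatrix C lam a x * frameMatrix C lam b x * lam x) := by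
    intro a b
    have e1 := matrixPartial_mul hs (h.smooth_connectionMatrix hx b) a
    have e2 : matrixPartial a (fun y => lam y * connectionMatrix C lam mu b y) x
        = matrixPartial a (fun y => matrixPartial b lam y
          + (1 / 2 : ℝ) • (frameMatrix C lam b y * lam y)) x := by
      refine matrixPartial_congr ?_ a
      filter_upwards [h.isOpen.mem_nhds hx] with y hy
      exact h.mul_connectionMatrix hy b
    have hf := (h.smooth_frameMatrix hx b).mul hs
    rw [matrixPartial_add (hs.matrixPartial b) (hf.const_smul _),
      matrixPartial_const_smul _ hf, matrixPartial_mul (h.smooth_frameMatrix hx b) hs, e1] at e2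
    rw [← mul_assoc, h.mul_connectionMatrix hx a, add_mul, smul_mul_assoc, mul_assoc,
      h.mul_connectionMatrix hx b, mul_add, mul_smul_comm, ← mul_assoc]
    linear_combination (norm := module) e2
  have hD := congrArg (· * lam x) (h.matrixPartial_frameMatrix_sub hx a b)
  simp only [sub_mul] at hD
  have hS := matrixPartial_comm hs a b
  rw [mul_add, mul_sub, mul_sub, sub_mul]
  linear_combination (norm := module) key a b - key b a + hS + (1 / 2 : ℝ) • hD

/-- The canonical connection is compatible with the invariant metric `tr (N_b N_d)`. -/
theorem matrixPartial_metric (a b d : Fin m) :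
    paraPartial a (fun y => (frameMatrix C lam b y * frameMatrix C lam d y).trace) x
      = ∑ f, ((frameMatrix C lam f x * frameMatrix C lam d x).trace
          * connectionMatrix C lam mu a x f b
        + (frameMatrix C lam b x * frameMatrix C lam f x).trace
          * connectionMatrix C lam mu a x f d) := by
  -- Solving the defining equation of the connection for `∂_a λ_b` and applying the linear map
  -- `structureMatrix C` leaves only half a commutator besides the connection term.
  have hN : ∀ b, matrixPartial a (frameMatrix C lam b) x
      = ∑ f, connectionMatrix C lam mu a x f b • frameMatrix C lam f x
        - (1 / 2 : ℝ) • (frameMatrix C lam a x * frameMatrix C lam b x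
          - frameMatrix C lam b x * frameMatrix C lam a x) := by
    intro b
    have e : (matrixPartial a lam x).col b
        = ∑ f, connectionMatrix C lam mu a x f b • (lam x).col f
          - (1 / 2 : ℝ) • (frameMatrix C lam a x *ᵥ (lam x).col b) := by
      funext d
      have := congrFun (congrFun (h.mul_connectionMatrix hx a) d) b
      rw [Matrix.mul_apply] at this
      simp only [col_apply, Pi.sub_apply, Finset.sum_apply, Pi.smul_apply, smul_eq_mul]
      have e3 : (frameMatrix C lam a x *ᵥ (lam x).col b) d = (frameMatrix C lam a x * lam x) d b :=
        rfl
      rw [e3, eq_sub_iff_add_eq]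
      refine this.symm.trans (Finset.sum_congr rfl fun f _ => mul_comm _ _)
    have hr : ∀ (r : ℝ) v, structureMatrix C (r • v) = r • structureMatrix C v := fun r v => by
      rw [← algebraMap_smul ParaComplex r v, map_smul, algebraMap_smul]
    rw [h.matrixPartial_frameMatrix hx, e, map_sub, map_sum, hr, h.structureMatrix_bracket hx]
    simp only [map_smul]
    rfl
  rw [paraPartial_trace ((h.smooth_frameMatrix hx b).mul (h.smooth_frameMatrix hx d)),
    matrixPartial_mul (h.smooth_frameMatrix hx b) (h.smooth_frameMatrix hx d), hN, hN]
  simp only [sub_mul, mul_sub, trace_add, trace_sub, smul_mul_assoc, mul_smul_comm, trace_smul,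
    Finset.sum_mul, Finset.mul_sum, trace_sum, Finset.sum_add_distrib, smul_eq_mul]
  -- Invariance of the trace form: `tr ([N_a, N_b] N_d) + tr (N_b [N_a, N_d]) = 0`, by cyclicity.
  have t1 : (frameMatrix C lam b x * (frameMatrix C lam a x * frameMatrix C lam d x)).trace
      = (frameMatrix C lam b x * frameMatrix C lam a x * frameMatrix C lam d x).trace := by
    rw [mul_assoc]
  have t2 : (frameMatrix C lam b x * (frameMatrix C lam d x * frameMatrix C lam a x)).trace
      = (frameMatrix C lam a x * frameMatrix C lam b x * frameMatrix C lam d x).trace := by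
    rw [← mul_assoc, trace_mul_comm, ← mul_assoc]
  rw [t1, t2]
  simp only [mul_comm (connectionMatrix C lam mu a x _ _)]
  module

omit h hx in
-- `L` is left arbitrary so that the result serves both the Christoffel symbols and the canonical
-- connection. Agreement near `x` is needed because `L` is differentiated.
theorem curvature_eq_matrix {L : Fin m → Fin m → Fin m → ParaSpace m → ParaComplex}
    (hL : ∀ y ∈ U, ∀ a b c, L a b c y = connectionMatrix C lam mu c y a b) (hU : U ∈ nhds x)
    (d c a b : Fin m) :
    curvature L d c a b x = (matrixPartial a (connectionMatrix C lam mu b) x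
        - matrixPartial b (connectionMatrix C lam mu a) x
        + (connectionMatrix C lam mu a x * connectionMatrix C lam mu b x
        - connectionMatrix C lam mu b x * connectionMatrix C lam mu a x)) d c := by
  have hx := mem_of_mem_nhds hU
  have hL' : ∀ a b c, L a b c =ᶠ[nhds x] fun y => connectionMatrix C lam mu c y a b :=
    fun a b c => Filter.eventually_of_mem hU fun y hy => hL y hy a b c
  simp only [curvature, paraPartial_congr (hL' _ _ _), hL x hx, Matrix.add_apply, Matrix.sub_apply,
    Matrix.mul_apply, matrixPartial, of_apply, ← Finset.sum_sub_distrib]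
  congr 1
  exact Finset.sum_congr rfl fun f _ => by ring

/-- By Jacobi, `[N_a, N_b] λ_c` is the bracket of `λ_c` with `N_a λ_b`, that is `-N_c N_a λ_b`. In
this form it is a fixed matrix applied to `λ_b`, and the sum over `b` is the trace of that matrix,
conjugated by `λ`. -/
theorem ricci_eq {L : Fin m → Fin m → Fin m → ParaSpace m → ParaComplex}
    (hL : ∀ y ∈ U, ∀ a b c, L a b c y = connectionMatrix C lam mu c y a b) (a c : Fin m) :
    ricci L a c x
      = (-(1 / 4) : ℝ) • (frameMatrix C lam a x * frameMatrix C lam c x).trace := by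
  have hU := h.isOpen.mem_nhds hx
  have key : ∀ b, curvature L b c b a x = (-(1 / 4) : ℝ) •
      (mu x * (frameMatrix C lam c x * frameMatrix C lam a x * lam x)) b b := by
    intro b
    have e1 := congrArg (mu x * ·) (h.curvature_connectionMatrix hx b a)
    simp only [← mul_assoc, h.inv_mul x hx, one_mul] at e1
    rw [curvature_eq_matrix hL hU, e1, ← h.structureMatrix_bracket hx]
    have e2 := structureMatrix_mulVec_antisymm h.antisymm
      (frameMatrix C lam a x *ᵥ (lam x).col b) ((lam x).col c)
    rw [mul_smul_comm, Matrix.smul_apply, neg_smul, ← smul_neg]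
    congr 1
    have e3 : ∀ A : Matrix (Fin m) (Fin m) ParaComplex,
        (mu x * A) b c = (mu x *ᵥ A.col c) b := fun _ => rfl
    have e4 : (mu x * (frameMatrix C lam c x * frameMatrix C lam a x * lam x)) b b
        = (mu x *ᵥ (frameMatrix C lam c x * frameMatrix C lam a x * lam x).col b) b := rfl
    have e5 : (frameMatrix C lam c x * frameMatrix C lam a x * lam x).col b
        = frameMatrix C lam c x *ᵥ frameMatrix C lam a x *ᵥ (lam x).col b := by
      rw [mulVec_mulVec]; rfl
    rw [e3, e4, e5, ← Pi.neg_apply, ← mulVec_neg]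
    exact congrFun (congrArg _ e2) b
  simp only [ricci, key, ← Finset.smul_sum]
  congr 1
  change trace _ = _
  rw [trace_mul_comm, mul_assoc, h.mul_inv hx, mul_one, trace_mul_comm]

theorem scalarCurvature_eq {L : Fin m → Fin m → Fin m → ParaSpace m → ParaComplex}
    (hL : ∀ y ∈ U, ∀ a b c, L a b c y = connectionMatrix C lam mu c y a b)
    {g : ParaSpace m → Matrix (Fin m) (Fin m) ParaComplex}
    (hg : ∀ y ∈ U, ∀ a b, g y a b = (frameMatrix C lam a y * frameMatrix C lam b y).trace)
    (hdet : IsUnit (g x).det) :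
    scalarCurvature g L x = algebraMap ℝ ParaComplex (-(1 / 4) * m) := by
  have e : ∀ a b, ricci L a b x = (-(1 / 4) : ℝ) • g x b a := fun a b => by
    rw [h.ricci_eq hx hL, hg x hx, trace_mul_comm]
  simp only [scalarCurvature, e, mul_smul_comm, ← Finset.smul_sum]
  have e1 : ∑ a, ∑ b, (g x)⁻¹ a b * g x b a = ((g x)⁻¹ * g x).trace := rfl
  rw [e1, nonsing_inv_mul _ hdet, trace_one, Fintype.card_fin, map_mul, Algebra.smul_def, map_natCast]

/-- Uniqueness of the Levi-Civita connection: compatibility expresses each `∂g` through `g Γ`, and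
symmetry of `Γ` collapses the six terms of the Koszul formula to two equal ones. -/
theorem christoffel_eq {g : ParaSpace m → Matrix (Fin m) (Fin m) ParaComplex}
    (hg : ∀ y ∈ U, ∀ a b, g y a b = (frameMatrix C lam a y * frameMatrix C lam b y).trace)
    (hdet : IsUnit (g x).det) (a b c : Fin m) :
    christoffel g a b c x = connectionMatrix C lam mu c x a b := by
  have hg' : ∀ a b, (fun y => g y a b) =ᶠ[nhds x]
      fun y => (frameMatrix C lam a y * frameMatrix C lam b y).trace :=
    fun a b => Filter.eventually_of_mem (h.isOpen.mem_nhds hx) fun y hy => hg y hy a b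
  have hsymm : ∀ a b, g x a b = g x b a := fun a b => by
    rw [hg x hx, hg x hx, trace_mul_comm]
  have hd : ∀ a b d, paraPartial a (fun y => g y b d) x
      = (g x * connectionMatrix C lam mu a x) d b + (g x * connectionMatrix C lam mu a x) b d := by
    intro a b d
    rw [paraPartial_congr (hg' b d), h.matrixPartial_metric hx, Finset.sum_add_distrib]
    simp only [Matrix.mul_apply, hsymm d, hg x hx]
  have hs : ∀ a b d, (g x * connectionMatrix C lam mu a x) d b
      = (g x * connectionMatrix C lam mu b x) d a := fun a b d => by
    simp only [Matrix.mul_apply, h.connectionMatrix_symm hx _ b a]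
  have hk : ∀ d, paraPartial b (fun y => g y c d) x + paraPartial c (fun y => g y b d) x
      - paraPartial d (fun y => g y b c) x = (2 : ℝ) • (g x * connectionMatrix C lam mu c x) d b := by
    intro d
    rw [hd, hd, hd, hs b c d, hs b d c, hs c d b]
    module
  simp only [christoffel, hk, mul_smul_comm, ← Finset.smul_sum, smul_smul]
  have e1 : ∑ d, (g x)⁻¹ a d * (g x * connectionMatrix C lam mu c x) d b
      = ((g x)⁻¹ * (g x * connectionMatrix C lam mu c x)) a b := rfl
  rw [e1, ← mul_assoc, nonsing_inv_mul _ hdet, one_mul]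
  norm_num

end IsMaurerCartanCoframe

/-! ### Pointwise para-holomorphy of maps between manifolds. -/

section ManifoldCalculus

/-- A map between manifolds is smooth at a point and its differential there commutes with the
para-complex structures. -/
def IsParaHolomorphicAt {E H M E' H' M' : Type*}
    [NormedAddCommGroup E] [NormedSpace ℝ E] [SMul ParaComplex E] [TopologicalSpace H]
    (I : ModelWithCorners ℝ E H) [TopologicalSpace M] [ChartedSpace H M]
    [NormedAddCommGroup E'] [NormedSpace ℝ E'] [SMul ParaComplex E'] [TopologicalSpace H']
    (I' : ModelWithCorners ℝ E' H') [TopologicalSpace M'] [ChartedSpace H' M']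
    (f : M → M') (x : M) : Prop :=
  ContMDiffAt I I' ∞ f x ∧
    let df : E →L[ℝ] E' := mfderiv I I' f x
    ∀ v : E, df (e • v) = e • df v

variable {E H M E' H' M' E'' H'' M'' : Type*}
  [NormedAddCommGroup E] [NormedSpace ℝ E] [SMul ParaComplex E] [TopologicalSpace H]
  {I : ModelWithCorners ℝ E H} [TopologicalSpace M] [ChartedSpace H M]
  [NormedAddCommGroup E'] [NormedSpace ℝ E'] [SMul ParaComplex E'] [TopologicalSpace H']
  {I' : ModelWithCorners ℝ E' H'} [TopologicalSpace M'] [ChartedSpace H' M']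
  [NormedAddCommGroup E''] [NormedSpace ℝ E''] [SMul ParaComplex E''] [TopologicalSpace H'']
  {I'' : ModelWithCorners ℝ E'' H''} [TopologicalSpace M''] [ChartedSpace H'' M'']

theorem IsParaHolomorphic.isParaHolomorphicAt {f : M → M'} (hf : IsParaHolomorphic I I' f) (x : M) :
    IsParaHolomorphicAt I I' f x :=
  ⟨hf.1 x, hf.2 x⟩

theorem IsParaHolomorphicAt.comp {g : M' → M''} {f : M → M'} {x : M}
    (hg : IsParaHolomorphicAt I' I'' g (f x)) (hf : IsParaHolomorphicAt I I' f x) :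
    IsParaHolomorphicAt I I'' (fun y => g (f y)) x := by
  refine ⟨hg.1.comp x hf.1, ?_⟩
  have h : mfderiv I I'' (fun y => g (f y)) x
      = (mfderiv I' I'' g (f x)).comp (mfderiv I I' f x) :=
    mfderiv_comp x (hg.1.mdifferentiableAt (by simp)) (hf.1.mdifferentiableAt (by simp))
  intro df v
  have h1 := hf.2 v
  have h2 := hg.2
  have h3 : ∀ v : E, df v = (mfderiv I' I'' g (f x) : E' →L[ℝ] E'')
      ((mfderiv I I' f x : E →L[ℝ] E') v) := fun v => congrArg (fun (L : E →L[ℝ] E'') => L v) h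
  rw [h3, h3]
  exact (congrArg _ h1).trans (h2 _)

theorem IsParaHolomorphicAt.prodMk {f : M → M'} {g : M → M''} {x : M}
    (hf : IsParaHolomorphicAt I I' f x) (hg : IsParaHolomorphicAt I I'' g x) :
    IsParaHolomorphicAt I (I'.prod I'') (fun y => (f y, g y)) x := by
  refine ⟨hf.1.prodMk hg.1, ?_⟩
  have h := mfderiv_prodMk (hf.1.mdifferentiableAt (by simp)) (hg.1.mdifferentiableAt (by simp))
  intro df v
  have h3 : ∀ v : E, df v = ((mfderiv I I' f x : E →L[ℝ] E') v,
      (mfderiv I I'' g x : E →L[ℝ] E'') v) :=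
    fun v => congrArg (fun (L : E →L[ℝ] E' × E'') => L v) h
  rw [h3, h3]
  exact Prod.ext (hf.2 v) (hg.2 v)

theorem isParaHolomorphicAt_iff {f : E → E'} {x : E} :
    IsParaHolomorphicAt 𝓘(ℝ, E) 𝓘(ℝ, E') f x ↔ ContDiffAt ℝ ∞ f x ∧ ParaDifferentiableAt f x := by
  simp only [IsParaHolomorphicAt, contMDiffAt_iff_contDiffAt, mfderiv_eq_fderiv,
    ParaDifferentiableAt]
  exact ⟨fun h => ⟨h.1, h.1.differentiableAt (by simp), h.2⟩, fun h => ⟨h.1, h.2.2⟩⟩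

end ManifoldCalculus

/-! ### Para-holomorphy of compatible charts and their inverses. -/

section Charts

variable {m : ℕ} {M : Type*} [TopologicalSpace M] [ChartedSpace (ParaSpace m) M]

theorem mem_paraHolomorphicGroupoid_iff {f : OpenPartialHomeomorph (ParaSpace m) (ParaSpace m)} :
    f ∈ paraHolomorphicGroupoid m ↔
      ParaHolomorphicOn f f.source ∧ ParaHolomorphicOn f.symm f.target := by
  rw [paraHolomorphicGroupoid, mem_groupoid_of_pregroupoid]
  exact ⟨fun h => ⟨h.1 f.open_source, h.2 f.open_target⟩, fun h => ⟨fun _ => h.1, fun _ => h.2⟩⟩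

theorem paraHolomorphicGroupoid_le :
    paraHolomorphicGroupoid m ≤ contDiffGroupoid ∞ 𝓘(ℝ, ParaSpace m) := by
  intro f hf
  replace hf := mem_paraHolomorphicGroupoid_iff.1 hf
  change f ∈ contDiffGroupoid ∞ 𝓘(ℝ, ParaSpace m)
  rw [contDiffGroupoid, mem_groupoid_of_pregroupoid]
  simpa [contDiffPregroupoid] using ⟨hf.1.1, hf.2.1⟩

variable [HasGroupoid M (paraHolomorphicGroupoid m)]

variable (M) in
theorem isManifold_of_paraHolomorphicGroupoid : IsManifold 𝓘(ℝ, ParaSpace m) ∞ M :=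
  { hasGroupoid_of_le ‹HasGroupoid M (paraHolomorphicGroupoid m)› paraHolomorphicGroupoid_le with }

/-- In the preferred chart at `y` the manifold differential of `ψ` is that of a transition map,
which belongs to the groupoid. -/
theorem IsParaHolomorphicChart.isParaHolomorphicAt {ψ : OpenPartialHomeomorph M (ParaSpace m)}
    (hψ : IsParaHolomorphicChart ψ) {y : M} (hy : y ∈ ψ.source) :
    IsParaHolomorphicAt 𝓘(ℝ, ParaSpace m) 𝓘(ℝ, ParaSpace m) ψ y := by
  have := isManifold_of_paraHolomorphicGroupoid (m := m) M
  have h1 : ContMDiffAt 𝓘(ℝ, ParaSpace m) 𝓘(ℝ, ParaSpace m) ∞ ψ y :=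
    contMDiffAt_of_mem_maximalAtlas
      (StructureGroupoid.maximalAtlas_mono paraHolomorphicGroupoid_le hψ) hy
  refine ⟨h1, ?_⟩
  have h2 := (mem_paraHolomorphicGroupoid_iff.1
    (StructureGroupoid.compatible_of_mem_maximalAtlas_right (x := y) hψ)).1
  have h3 := (h1.mdifferentiableAt (by simp)).mfderiv
  simp only [mfld_simps] at h3
  intro df v
  have h4 : ∀ v, df v = fderiv ℝ ((chartAt (ParaSpace m) y).symm ≫ₕ ψ) (chartAt (ParaSpace m) y y) v := by
    intro v
    have := congrArg (fun (L : ParaSpace m →L[ℝ] ParaSpace m) => L v) h3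
    simpa [chartAt_self_eq] using this
  rw [h4, h4]
  exact h2.2 _ (by simp [hy]) v

theorem IsParaHolomorphicChart.isParaHolomorphicAt_symm
    {ψ : OpenPartialHomeomorph M (ParaSpace m)}
    (hψ : IsParaHolomorphicChart ψ) {x : ParaSpace m} (hx : x ∈ ψ.target) :
    IsParaHolomorphicAt 𝓘(ℝ, ParaSpace m) 𝓘(ℝ, ParaSpace m) ψ.symm x := by
  have := isManifold_of_paraHolomorphicGroupoid (m := m) M
  have h1 : ContMDiffAt 𝓘(ℝ, ParaSpace m) 𝓘(ℝ, ParaSpace m) ∞ ψ.symm x :=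
    contMDiffAt_symm_of_mem_maximalAtlas
      (StructureGroupoid.maximalAtlas_mono paraHolomorphicGroupoid_le hψ) hx
  refine ⟨h1, ?_⟩
  have h2 := (mem_paraHolomorphicGroupoid_iff.1
    (StructureGroupoid.compatible_of_mem_maximalAtlas_left (x := ψ.symm x) hψ)).1
  have h3 := (h1.mdifferentiableAt (by simp)).mfderiv
  simp only [mfld_simps] at h3
  intro df v
  have h4 : ∀ v, df v = fderiv ℝ (ψ.symm ≫ₕ chartAt (ParaSpace m) (ψ.symm x)) x v := by
    intro v
    have := congrArg (fun (L : ParaSpace m →L[ℝ] ParaSpace m) => L v) h3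
    simpa [chartAt_self_eq] using this
  rw [h4, h4]
  exact h2.2 _ (by simp [hx]) v

end Charts

/-! ### Group operations in coordinates. -/

section LocalExpressions

variable {m : ℕ} {G : Type*} [Group G] [TopologicalSpace G] [ChartedSpace (ParaSpace m) G]
  [ParaComplexLieGroup m G] {α : OpenPartialHomeomorph G (ParaSpace m)}

theorem IsParaHolomorphicAt.mul {V : Type*} [NormedAddCommGroup V] [NormedSpace ℝ V]
    [SMul ParaComplex V] {f g : V → G} {x : V}
    (hf : IsParaHolomorphicAt 𝓘(ℝ, V) 𝓘(ℝ, ParaSpace m) f x)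
    (hg : IsParaHolomorphicAt 𝓘(ℝ, V) 𝓘(ℝ, ParaSpace m) g x) :
    IsParaHolomorphicAt 𝓘(ℝ, V) 𝓘(ℝ, ParaSpace m) (fun y => f y * g y) x :=
  IsParaHolomorphicAt.comp (g := fun p : G × G => p.1 * p.2)
    (ParaComplexLieGroup.mul_paraHolomorphic.isParaHolomorphicAt _) (hf.prodMk hg)

theorem IsParaHolomorphicAt.inv {V : Type*} [NormedAddCommGroup V] [NormedSpace ℝ V]
    [SMul ParaComplex V] {f : V → G} {x : V}
    (hf : IsParaHolomorphicAt 𝓘(ℝ, V) 𝓘(ℝ, ParaSpace m) f x) :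
    IsParaHolomorphicAt 𝓘(ℝ, V) 𝓘(ℝ, ParaSpace m) (fun y => (f y)⁻¹) x :=
  IsParaHolomorphicAt.comp (g := fun z : G => z⁻¹)
    (ParaComplexLieGroup.inv_paraHolomorphic.isParaHolomorphicAt _) hf

omit [Group G] [ParaComplexLieGroup m G] in
theorem IsParaHolomorphicChart.comp_paraHolomorphicAt
    [HasGroupoid G (paraHolomorphicGroupoid m)] {V : Type*} [NormedAddCommGroup V]
    [NormedSpace ℝ V] [SMul ParaComplex V] (hα : IsParaHolomorphicChart α) {f : V → G} {x : V}
    (hf : IsParaHolomorphicAt 𝓘(ℝ, V) 𝓘(ℝ, ParaSpace m) f x) (h : f x ∈ α.source) :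
    ContDiffAt ℝ ∞ (fun y => α (f y)) x ∧ ParaDifferentiableAt (fun y => α (f y)) x :=
  isParaHolomorphicAt_iff.1 (IsParaHolomorphicAt.comp (hα.isParaHolomorphicAt h) hf)

omit [Group G] [ParaComplexLieGroup m G] in
theorem IsParaHolomorphicAt.eventually_mem_source {V : Type*} [NormedAddCommGroup V]
    [NormedSpace ℝ V] [SMul ParaComplex V] {f : V → G} {x : V}
    (hf : IsParaHolomorphicAt 𝓘(ℝ, V) 𝓘(ℝ, ParaSpace m) f x) (h : f x ∈ α.source) :
    ∀ᶠ y in nhds x, f y ∈ α.source :=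
  hf.1.continuousAt.eventually_mem (α.open_source.mem_nhds h)

omit [Group G] [ParaComplexLieGroup m G] in
theorem isParaHolomorphicAt_const {V : Type*} [NormedAddCommGroup V] [NormedSpace ℝ V]
    [SMul ParaComplex V] (z : G) (x : V) :
    IsParaHolomorphicAt 𝓘(ℝ, V) 𝓘(ℝ, ParaSpace m) (fun _ => z) x := by
  refine ⟨contMDiffAt_const, ?_⟩
  intro df v
  have h : ∀ v, df v = 0 := fun v =>
    congrArg (fun (L : V →L[ℝ] ParaSpace m) => L v) (mfderiv_const (c := z) (x := x))
  rw [h, h, smul_zero]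

omit [Group G] [ParaComplexLieGroup m G] in
theorem IsParaHolomorphicChart.isParaHolomorphicAt_symm_fst
    [HasGroupoid G (paraHolomorphicGroupoid m)] (hα : IsParaHolomorphicChart α)
    {p : ParaSpace m × ParaSpace m} (hp : p.1 ∈ α.target) :
    IsParaHolomorphicAt 𝓘(ℝ, ParaSpace m × ParaSpace m) 𝓘(ℝ, ParaSpace m)
      (fun q => α.symm q.1) p :=
  (hα.isParaHolomorphicAt_symm hp).comp (isParaHolomorphicAt_iff.2
    ⟨contDiffAt_fst, differentiableAt_fst, fun v => by simp [fderiv_fst]⟩)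

omit [Group G] [ParaComplexLieGroup m G] in
theorem IsParaHolomorphicChart.isParaHolomorphicAt_symm_snd
    [HasGroupoid G (paraHolomorphicGroupoid m)] (hα : IsParaHolomorphicChart α)
    {p : ParaSpace m × ParaSpace m} (hp : p.2 ∈ α.target) :
    IsParaHolomorphicAt 𝓘(ℝ, ParaSpace m × ParaSpace m) 𝓘(ℝ, ParaSpace m)
      (fun q => α.symm q.2) p :=
  (hα.isParaHolomorphicAt_symm hp).comp (isParaHolomorphicAt_iff.2
    ⟨contDiffAt_snd, differentiableAt_snd, fun v => by simp [fderiv_snd]⟩)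

end LocalExpressions

/-! ### Right-invariant forms and the Killing metric of the group. -/

namespace ParaComplexLieGroup

variable {m : ℕ} {G : Type*} [Group G] [TopologicalSpace G] [ChartedSpace (ParaSpace m) G]
  [ParaComplexLieGroup m G] {u ψ : OpenPartialHomeomorph G (ParaSpace m)}

/-- The inverse of the matrix of right-invariant forms: the derivative of `ψ (w z)` in the
coordinates `u` of `w`, at the identity. -/
def rightField (u ψ : OpenPartialHomeomorph G (ParaSpace m)) (x : ParaSpace m) :
    Matrix (Fin m) (Fin m) ParaComplex :=
  fun a b => paraPartial b (fun w => ψ (u.symm w * ψ.symm x) a) (u 1)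

variable (hu : IsParaHolomorphicChart u) (h_one : (1 : G) ∈ u.source)
  (hψ : IsParaHolomorphicChart ψ)

section

include hψ

theorem isParaHolomorphicAt_symm_mul_const (c : G) {x : ParaSpace m} (hx : x ∈ ψ.target) :
    IsParaHolomorphicAt 𝓘(ℝ, ParaSpace m) 𝓘(ℝ, ParaSpace m) (fun y => ψ.symm y * c) x :=
  (hψ.isParaHolomorphicAt_symm hx).mul (isParaHolomorphicAt_const c x)

end

include hu h_one hψ

/-- The base point enters both as a parameter and as the point of evaluation, hence joint smoothness
in two variables is used. -/
theorem smooth_rightForm {x : ParaSpace m} (hx : x ∈ ψ.target) :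
    MatrixSmoothAt (rightForm u ψ) x := by
  intro a b
  refine contDiffAt_paraPartial_param b (k := id)
    (h := fun y x' => u (ψ.symm x' * (ψ.symm y)⁻¹) a) ?_ contDiffAt_id
  exact contDiffAt_pi.1 (hu.comp_paraHolomorphicAt (x := (x, x))
    ((hψ.isParaHolomorphicAt_symm_snd hx).mul (hψ.isParaHolomorphicAt_symm_fst hx).inv)
    (by simpa using h_one)).1 a

theorem smooth_rightField {x : ParaSpace m} (hx : x ∈ ψ.target) :
    MatrixSmoothAt (rightField u ψ) x := by
  intro a b
  refine contDiffAt_paraPartial_param b (k := fun _ => u 1)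
    (h := fun y w => ψ (u.symm w * ψ.symm y) a) ?_ contDiffAt_const
  exact contDiffAt_pi.1 (hψ.comp_paraHolomorphicAt (x := (x, u 1))
    ((hu.isParaHolomorphicAt_symm_snd (u.map_source h_one)).mul
      (hψ.isParaHolomorphicAt_symm_fst hx))
    (by simpa [u.left_inv h_one] using ψ.map_target hx)).1 a

/-- Chain rule for the factorization `z' = (z' z⁻¹) z` of the identity map. -/
theorem rightField_mul_rightForm {x : ParaSpace m} (hx : x ∈ ψ.target) :
    rightField u ψ x * rightForm u ψ x = 1 := by
  have hR := isParaHolomorphicAt_symm_mul_const hψ (ψ.symm x)⁻¹ hx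
  have hRx : ψ.symm x * (ψ.symm x)⁻¹ ∈ u.source := by simpa using h_one
  have hF := hu.comp_paraHolomorphicAt hR hRx
  have hFx : u (ψ.symm x * (ψ.symm x)⁻¹) = u 1 := by simp
  have hK := (hψ.comp_paraHolomorphicAt
    (isParaHolomorphicAt_symm_mul_const hu (ψ.symm x) (u.map_source h_one))
    (by simpa [u.left_inv h_one] using ψ.map_target hx)).1
  ext1 a b
  have hc := paraPartial_comp (g := fun w => ψ (u.symm w * ψ.symm x) a) hF.2
    (by rw [hFx]; exact (contDiffAt_pi.1 hK a).differentiableAt (by simp)) b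
  rw [hFx] at hc
  rw [← paraPartial_coord a b x]
  refine hc.symm.trans (paraPartial_congr ?_)
  filter_upwards [hR.eventually_mem_source hRx, ψ.open_target.mem_nhds hx] with y hy hyt
  rw [u.left_inv hy, inv_mul_cancel_right, ψ.right_inv hyt]

omit hψ

theorem contDiffAt_leftFactor_partial (a p : Fin m) :
    ContDiffAt ℝ ∞
      (fun w => paraPartial p (fun z => u (u.symm z * u.symm w) a) (u 1)) (u 1) := by
  refine contDiffAt_paraPartial_param p (k := fun _ => u 1)
    (h := fun w z => u (u.symm z * u.symm w) a) ?_ contDiffAt_const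
  have ht := u.map_source h_one
  exact contDiffAt_pi.1 (hu.comp_paraHolomorphicAt (x := (u 1, u 1))
    ((hu.isParaHolomorphicAt_symm_snd ht).mul (hu.isParaHolomorphicAt_symm_fst ht))
    (by simpa [u.left_inv h_one] using h_one)).1 a

omit hu [ChartedSpace (ParaSpace m) G] [ParaComplexLieGroup m G] in
theorem leftFactor_partial_one (a p : Fin m) :
    paraPartial p (fun z => u (u.symm z * u.symm (u 1)) a) (u 1)
      = (1 : Matrix (Fin m) (Fin m) ParaComplex) a p := by
  rw [← paraPartial_coord a p (u 1)]
  refine paraPartial_congr ?_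
  filter_upwards [u.open_target.mem_nhds (u.map_source h_one)] with y hy
  rw [u.left_inv h_one, mul_one, u.right_inv hy]

include hψ

/-- Chain rule for `y c = (y x⁻¹)(x c)`: the inner factor passes through the identity and
contributes `λ`. The outer coefficient depends on `x` only through `x c`. -/
theorem partial_rightTranslation (c : G) {x : ParaSpace m} (hx : x ∈ ψ.target)
    (hxc : ψ.symm x * c ∈ u.source) (a b : Fin m) :
    paraPartial b (fun y => u (ψ.symm y * c) a) x
      = ∑ p, paraPartial p (fun z => u (u.symm z * u.symm (u (ψ.symm x * c))) a) (u 1)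
          * rightForm u ψ x p b := by
  have hR := isParaHolomorphicAt_symm_mul_const hψ (ψ.symm x)⁻¹ hx
  have hRx : ψ.symm x * (ψ.symm x)⁻¹ ∈ u.source := by simpa using h_one
  have hF := hu.comp_paraHolomorphicAt hR hRx
  have hFx : u (ψ.symm x * (ψ.symm x)⁻¹) = u 1 := by simp
  rw [u.left_inv hxc]
  have hK := (hu.comp_paraHolomorphicAt
    (isParaHolomorphicAt_symm_mul_const hu (ψ.symm x * c) (u.map_source h_one))
    (by simpa [u.left_inv h_one] using hxc)).1
  have hc := paraPartial_comp (g := fun z => u (u.symm z * (ψ.symm x * c)) a) hF.2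
    (by rw [hFx]; exact (contDiffAt_pi.1 hK a).differentiableAt (by simp)) b
  rw [hFx] at hc
  refine Eq.trans (paraPartial_congr ?_) hc
  filter_upwards [hR.eventually_mem_source hRx] with y hy
  rw [u.left_inv hy, ← mul_assoc, inv_mul_cancel_right]

/-- The right factor `x⁻¹` stays frozen under both derivatives, whereas in `rightForm` it moves with
the base point. By the product rule, differentiating the outer coefficient at the identity gives
`mulCoeff`, while its value there is the identity matrix. -/
theorem second_partial_rightTranslation {x : ParaSpace m} (hx : x ∈ ψ.target) (a b c : Fin m) :
    paraPartial c (fun x' => paraPartial b (fun y => u (ψ.symm y * (ψ.symm x)⁻¹) a) x') x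
      = (∑ p, ∑ q, mulCoeff u a p q * rightForm u ψ x p b * rightForm u ψ x q c)
        + paraPartial c (fun y => rightForm u ψ y a b) x := by
  have hR := isParaHolomorphicAt_symm_mul_const hψ (ψ.symm x)⁻¹ hx
  have hRx : ψ.symm x * (ψ.symm x)⁻¹ ∈ u.source := by simpa using h_one
  have hF := hu.comp_paraHolomorphicAt hR hRx
  have hFx : u (ψ.symm x * (ψ.symm x)⁻¹) = u 1 := by simp
  set M : Fin m → Fin m → ParaSpace m → ParaComplex :=
    fun a p w => paraPartial p (fun z => u (u.symm z * u.symm w) a) (u 1) with hM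
  have hMs : ∀ p, DifferentiableAt ℝ (M a p) (u (ψ.symm x * (ψ.symm x)⁻¹)) := fun p => by
    rw [hFx]; exact (contDiffAt_leftFactor_partial hu h_one a p).differentiableAt (by simp)
  have hMF : ∀ p, DifferentiableAt ℝ (fun y => M a p (u (ψ.symm y * (ψ.symm x)⁻¹))) x := fun p =>
    DifferentiableAt.comp (f := fun y => u (ψ.symm y * (ψ.symm x)⁻¹)) x (hMs p) hF.2.1
  have hlam := smooth_rightForm hu h_one hψ hx
  have e1 : (fun x' => paraPartial b (fun y => u (ψ.symm y * (ψ.symm x)⁻¹) a) x') =ᶠ[nhds x]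
      fun x' => ∑ p, M a p (u (ψ.symm x' * (ψ.symm x)⁻¹)) * rightForm u ψ x' p b := by
    filter_upwards [hR.eventually_mem_source hRx, ψ.open_target.mem_nhds hx] with y hy hyt
    exact partial_rightTranslation hu h_one hψ _ hyt hy a b
  rw [paraPartial_congr e1, paraPartial_sum _ _ fun p =>
    (hasFDerivAt_mul (hMF p).hasFDerivAt
      (hlam.differentiableAt p b).hasFDerivAt).differentiableAt]
  have e2 : ∀ p, paraPartial c
      (fun x' => M a p (u (ψ.symm x' * (ψ.symm x)⁻¹)) * rightForm u ψ x' p b) x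
      = (∑ q, mulCoeff u a p q * rightForm u ψ x p b * rightForm u ψ x q c)
        + (1 : Matrix (Fin m) (Fin m) ParaComplex) a p
          * paraPartial c (fun y => rightForm u ψ y p b) x := by
    intro p
    rw [paraPartial_mul c (hMF p) (hlam.differentiableAt p b), paraPartial_comp hF.2 (hMs p), hFx,
      Finset.sum_mul]
    congr 1
    · exact Finset.sum_congr rfl fun q _ => mul_right_comm _ _ _
    · exact congrArg (· * _) (leftFactor_partial_one h_one a p)
  rw [Finset.sum_congr rfl fun p _ => e2 p, Finset.sum_add_distrib]
  congr 1
  simp [Matrix.one_apply]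

/-- The right-invariant forms satisfy the Maurer-Cartan equation. -/
theorem maurerCartan_rightForm {x : ParaSpace m} (hx : x ∈ ψ.target) (a b c : Fin m) :
    paraPartial c (fun y => rightForm u ψ y a b) x - paraPartial b (fun y => rightForm u ψ y a c) x
      = -∑ p, ∑ q, structureConst u a p q * rightForm u ψ x p b * rightForm u ψ x q c := by
  have hF := hu.comp_paraHolomorphicAt
    (isParaHolomorphicAt_symm_mul_const hψ (ψ.symm x)⁻¹ hx) (by simpa using h_one)
  -- Commuting the two derivatives of the frozen right translation leaves only the part of
  -- `mulCoeff` antisymmetric in its lower indices, namely the structure constants.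
  have hs := paraPartial_comm c b (contDiffAt_pi.1 hF.1 a)
  rw [second_partial_rightTranslation hu h_one hψ hx,
    second_partial_rightTranslation hu h_one hψ hx] at hs
  have e : ∑ p, ∑ q, structureConst u a p q * rightForm u ψ x p b * rightForm u ψ x q c
      = (∑ p, ∑ q, mulCoeff u a p q * rightForm u ψ x p b * rightForm u ψ x q c)
        - ∑ p, ∑ q, mulCoeff u a p q * rightForm u ψ x p c * rightForm u ψ x q b := by
    conv_rhs => rw [Finset.sum_comm (f := fun p q => _ * rightForm u ψ x p c * _)]
    simp only [← Finset.sum_sub_distrib]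
    refine Finset.sum_congr rfl fun p _ => Finset.sum_congr rfl fun q _ => ?_
    rw [structureConst]; ring
  rw [e]
  linear_combination hs

theorem isMaurerCartanCoframe :
    IsMaurerCartanCoframe (structureConst u) (rightForm u ψ) (rightField u ψ) ψ.target where
  antisymm _ _ _ := (neg_sub _ _).symm
  isOpen := ψ.open_target
  smooth _ hx := smooth_rightForm hu h_one hψ hx
  smooth_inv _ hx := smooth_rightField hu h_one hψ hx
  inv_mul _ hx := rightField_mul_rightForm hu h_one hψ hx
  maurerCartan _ hx a b c := maurerCartan_rightForm hu h_one hψ hx a b c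

theorem canonicalConnection_eq {x : ParaSpace m} (hx : x ∈ ψ.target) (a b c : Fin m) :
    canonicalConnection u ψ a b c x
      = connectionMatrix (structureConst u) (rightForm u ψ) (rightField u ψ) c x a b := by
  rw [canonicalConnection, Matrix.inv_eq_left_inv (rightField_mul_rightForm hu h_one hψ hx),
    connectionMatrix, Matrix.mul_apply]
  refine Finset.sum_congr rfl fun d _ => ?_
  simp only [Matrix.add_apply, Matrix.smul_apply, Matrix.mul_apply, matrixPartial, Matrix.of_apply,
    frameMatrix, structureMatrix_apply, Matrix.col_apply, Finset.sum_mul]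
  congr 3
  exact Finset.sum_congr rfl fun p _ => Finset.sum_congr rfl fun q _ => mul_right_comm _ _ _

omit hu h_one hψ [ChartedSpace (ParaSpace m) G] [ParaComplexLieGroup m G]

theorem killingMetric_eq_trace (x : ParaSpace m) (a b : Fin m) :
    killingMetric u ψ x a b = (frameMatrix (structureConst u) (rightForm u ψ) a x
      * frameMatrix (structureConst u) (rightForm u ψ) b x).trace := by
  let S : Fin m → Matrix (Fin m) (Fin m) ParaComplex :=
    fun q => Matrix.of fun d p => structureConst u d p q
  have hN : ∀ a, frameMatrix (structureConst u) (rightForm u ψ) a x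
      = ∑ q, rightForm u ψ x q a • S q := by
    intro a
    ext1 d p
    rw [frameMatrix, structureMatrix_apply, Matrix.sum_apply]
    exact Finset.sum_congr rfl fun q _ => mul_comm _ _
  have hK : ∀ p q, cartanKilling u p q = (S p * S q).trace := by
    intro p q
    refine Finset.sum_congr rfl fun c _ => Finset.sum_congr rfl fun d _ => ?_
    -- The lower indices are exchanged in both factors, and the two signs cancel.
    simp only [S, Matrix.of_apply, structureConst]
    ring
  simp only [killingMetric, hN, hK, Finset.sum_mul, Finset.mul_sum, Matrix.trace_sum,
    smul_mul_assoc, mul_smul_comm, Matrix.trace_smul, smul_eq_mul]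
  rw [Finset.sum_comm]
  exact Finset.sum_congr rfl fun p _ => Finset.sum_congr rfl fun q _ => by ring

theorem killingMetric_eq_mul (x : ParaSpace m) :
    killingMetric u ψ x = (rightForm u ψ x).transpose * cartanKilling u * rightForm u ψ x := by
  ext1 a b
  simp only [killingMetric, Matrix.mul_apply, Matrix.transpose_apply, Finset.sum_mul]
  rw [Finset.sum_comm]
  exact Finset.sum_congr rfl fun p _ => Finset.sum_congr rfl fun q _ => by ring

/-- The metric is congruent to the constant Killing form through the invertible `λ`, so
nondegeneracy at the identity spreads over the whole chart. -/
theorem isUnit_det_killingMetric (h_ss : IsSemisimple u) {x : ParaSpace m}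
    (hx : rightField u ψ x * rightForm u ψ x = 1) : IsUnit (killingMetric u ψ x).det := by
  have hl : IsUnit (rightForm u ψ x).det := Matrix.isUnit_det_of_left_inverse hx
  rw [killingMetric_eq_mul, Matrix.det_mul, Matrix.det_mul, Matrix.det_transpose]
  exact (hl.mul h_ss).mul hl

end ParaComplexLieGroup

end

/-! ### Scalar curvature of the group. -/

theorem mainTheorem11 {m : ℕ} {G : Type*} [Group G] [TopologicalSpace G]
    [ChartedSpace (ParaSpace m) G] [ParaComplexLieGroup m G]
    (u : OpenPartialHomeomorph G (ParaSpace m)) (hu : IsParaHolomorphicChart u)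
    (h_one : (1 : G) ∈ u.source) (h_ss : ParaComplexLieGroup.IsSemisimple u)
    (ψ : OpenPartialHomeomorph G (ParaSpace m)) (hψ : IsParaHolomorphicChart ψ)
    (z : G) (hz : z ∈ ψ.source) :
    scalarCurvature (ParaComplexLieGroup.killingMetric u ψ)
        (christoffel (ParaComplexLieGroup.killingMetric u ψ)) (ψ z)
      = algebraMap ℝ ParaComplex (-(1 / 4) * m) ∧
    scalarCurvature (ParaComplexLieGroup.killingMetric u ψ)
        (ParaComplexLieGroup.canonicalConnection u ψ) (ψ z)
      = algebraMap ℝ ParaComplex (-(1 / 4) * m) := by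
  have h := ParaComplexLieGroup.isMaurerCartanCoframe hu h_one hψ
  have hx := ψ.map_source hz
  have hg : ∀ y ∈ ψ.target, ∀ a b, _ := fun y _ a b =>
    ParaComplexLieGroup.killingMetric_eq_trace (u := u) (ψ := ψ) y a b
  have hdet : ∀ y ∈ ψ.target, IsUnit (ParaComplexLieGroup.killingMetric u ψ y).det := fun y hy =>
    ParaComplexLieGroup.isUnit_det_killingMetric h_ss (h.inv_mul y hy)
  -- Both connections agree with `connectionMatrix` on the whole of `ψ.target`, not just at `ψ z`,
  -- so their derivatives agree as well.
  exact ⟨h.scalarCurvature_eq hx (fun y hy => h.christoffel_eq hy hg (hdet y hy)) hg (hdet _ hx),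
    h.scalarCurvature_eq hx
      (fun y hy => ParaComplexLieGroup.canonicalConnection_eq hu h_one hψ hy) hg (hdet _ hx)⟩
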